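/- All graphs are finite and simple. For a vertex $v$ of a graph $G$ let $N[v]$ be the set consisting of $v$ and its neighbours; $G$ is \emph{twin-free} if $N[u]\ne N[v]$ for all distinct vertices $u,v$. A \emph{proper interval representation} of $G$ assigns to each vertex $v$ an interval $\alpha(v)$ of the linearly ordered set $\{1,\dots,m\}$ (for some $m$) such that distinct vertices $u,v$ are adjacent if and only if $\alpha(u)\cap\alpha(v)\ne\emptyset$, and $\alpha(u)\not\subseteq\alpha(v)$ for all distinct $u,v$. A \emph{proper arc representation} is defined in the same way, with arcs of the circle $\mathbb{C}_m$ (the set $\{1,\dots,m\}$ with the circular order $1\prec 2\prec\dots\prec m\prec 1$) in place of intervals; here the arc $[a,b]$ consists of the points on the directed path from $a$ to $b$. A graph having a proper interval (respectively arc) representation is called a \emph{proper interval} (respectively \emph{proper circular-arc}, PCA) graph. A proper interval or arc representation of an $n$-vertex graph is \emph{sharp} if $m=2n$ and the $n$ intervals or arcs $[l_v,r_v]$ share no endpoints, that is, the $2n$ points $l_v,r_v$ are pairwise distinct (so that every point is an endpoint). The \emph{reflection} is the map $x\mapsto m+1-x$, a \emph{rotation} is a map $x\mapsto x+s$ taken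 modulo $m$ in $\{1,\dots,m\}$, and maps $\sigma$ of the points act on representations by $\alpha\mapsto\sigma\circ\alpha$, where $(\sigma\circ\alpha)(v)=\sigma(\alpha(v))$. \textbf{Theorem.} (1) Every twin-free, connected proper interval graph has a sharp proper interval representation, and any two of its sharp proper interval representations are equal or are obtained from each other by reflection. (2) Every twin-free, connected PCA graph whose complement is non-bipartite or connected has a sharp proper arc representation, and any two of its sharp proper arc representations are obtained from each other by a rotation or by a rotation followed by reflection. -/

import Mathlib

namespace PropRepr

variable {V : Type*} {m : ℕ}

/-- The closed neighbourhood `N[v]` of a vertex. -/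
def closedNbhd (G : SimpleGraph V) (v : V) : Set V := insert v (G.neighborSet v)

/-- No two distinct vertices have the same closed neighbourhood. -/
def TwinFree (G : SimpleGraph V) : Prop :=
  ∀ u v : V, closedNbhd G u = closedNbhd G v → u = v

/-- The circle with `m` points is `Fin m`, each `x` being followed by `x + 1` (mod `m`).
`arc a b` consists of the points met when walking from `a` clockwise up to `b`: here `x - a` and
`b - a` are differences modulo `m`, that is, the lengths of the clockwise walks from `a`. -/
def arc (a b : Fin m) : Set (Fin m) := {x | x - a ≤ b - a}

/-- Arcs of the circle; the empty and the complete arc are allowed. -/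
def IsArc (S : Set (Fin m)) : Prop :=
  S = ∅ ∨ S = Set.univ ∨ ∃ a b : Fin m, S = arc a b

/-- Intervals of the linearly ordered segment `Fin m`; the empty interval is allowed. -/
def IsInterval (S : Set (Fin m)) : Prop :=
  S = ∅ ∨ ∃ a b : Fin m, a ≤ b ∧ S = Set.Icc a b

/-- `α` is an intersection representation of `G`: distinct vertices are adjacent exactly when
their sets meet. -/
def IsIntersectionRep (G : SimpleGraph V) (α : V → Set (Fin m)) : Prop :=
  ∀ u v : V, u ≠ v → (G.Adj u v ↔ (α u ∩ α v).Nonempty)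

/-- Among the sets `α v`, none is contained in another one. In particular `α` is injective. -/
def IsProper (α : V → Set (Fin m)) : Prop :=
  ∀ u v : V, u ≠ v → ¬ α u ⊆ α v

/-- Proper interval representations of `G` in the segment with `m` points. -/
structure IsProperIntervalRep (G : SimpleGraph V) (α : V → Set (Fin m)) : Prop where
  interval : ∀ v, IsInterval (α v)
  rep : IsIntersectionRep G α
  proper : IsProper α

/-- Proper arc representations of `G` on the circle with `m` points. -/
structure IsProperArcRep (G : SimpleGraph V) (α : V → Set (Fin m)) : Prop where
  arc : ∀ v, IsArc (α v)
  rep : IsIntersectionRep G α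
  proper : IsProper α

/-- Proper interval graphs. -/
def IsProperIntervalGraph (G : SimpleGraph V) : Prop :=
  ∃ (m : ℕ) (α : V → Set (Fin m)), IsProperIntervalRep G α

/-- Proper circular-arc (PCA) graphs. -/
def IsPCAGraph (G : SimpleGraph V) : Prop :=
  ∃ (m : ℕ) (α : V → Set (Fin m)), IsProperArcRep G α

/-- A system of intervals `[l v, r v]` is sharp if every point is an endpoint of exactly one of
them, as exactly one of its two endpoints. So no endpoint is shared, there is no point that is
not an endpoint, and the number of points is `2 * |V|`. -/
def IsSharpIntervals (α : V → Set (Fin m)) : Prop :=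
  ∃ l r : V → Fin m, (∀ v, l v ≤ r v ∧ α v = Set.Icc (l v) (r v)) ∧
    Function.Bijective (Sum.elim l r)

/-- The same for a system of arcs with start points `l v` and end points `r v`. -/
def IsSharpArcs (α : V → Set (Fin m)) : Prop :=
  ∃ l r : V → Fin m, (∀ v, α v = arc (l v) (r v)) ∧
    Function.Bijective (Sum.elim l r)

/-- Equality up to the reflection `x ↦ m - 1 - x` of the segment. -/
def EqUpToReflection (α β : V → Set (Fin m)) : Prop :=
  β = α ∨ ∀ v, β v = Fin.rev '' α v

/-- Symmetries of the circle: the rotations `x ↦ x + s` (mod `m`), and these followed by the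
reflection `x ↦ m - 1 - x`. -/
def IsCircleSymmetry (σ : Fin m → Fin m) : Prop :=
  ∃ s : Fin m, (∀ x, σ x = x + s) ∨ (∀ x, σ x = Fin.rev (x + s))

/-- Equality up to rotation and reflection of the circle. -/
def EqUpToRotationReflection (α β : V → Set (Fin m)) : Prop :=
  ∃ σ : Fin m → Fin m, IsCircleSymmetry σ ∧ ∀ v, β v = σ '' α v

end PropRepr

/-! Uniqueness: in a sharp model, orient an edge from `u` to `v` when the start point of `v` lies on
the arc of `u` (`Reaches`). If no two arcs meet at both ends, each edge gets one direction, and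
nonadjacent neighbours of a vertex lie on opposite sides of it (`IsLocalOrientation`).
Twin-freeness, together with a connected complement or with linearity, rules out triangles on which
two such orientations partly agree, so on a connected graph they agree everywhere or are opposite
everywhere (`agree_or_reversed`). Opposite orientations are matched by reflecting one model.

The orientation determines the model: every point is an endpoint of exactly one arc, so distances
between endpoints are numbers of endpoints, and these can be read off from `Reaches`
(`val_sub_eq_of_reaches_iff`, `length_eq_of_reaches_iff`). Only a common shift remains free, and for
intervals not even that. A non-bipartite complement is reduced to a connected one.

Existence: in a proper representation start points are distinct and so are end points. Placing
starts before ends at a shared position and discarding the other points preserves intersections.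
Only for arcs can this create a containment, and then the graph is complete, against twin-freeness.
-/

namespace PropRepr

/-! ### Rigidity of local orientations of a twin-free graph. -/

section Orientation

variable {V : Type*} {G : SimpleGraph V}

/-- A property that is inherited by neighbours holds everywhere in a connected graph if it holds
somewhere. -/
theorem of_connected_of_adj (hG : G.Connected) {p : V → Prop}
    (h : ∀ u v, G.Adj u v → p u → p v) {u : V} (hu : p u) (v : V) : p v := by
  obtain ⟨w⟩ := hG.preconnected u v
  induction w with
  | nil => exact hu
  | cons hadj _ ih => exact ih (h _ _ hadj hu)

/-- The relation `A` orients every edge of `G` in exactly one direction, and two nonadjacent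
neighbours of a vertex are never both out-neighbours or both in-neighbours of it. -/
structure IsLocalOrientation (G : SimpleGraph V) (A : V → V → Prop) : Prop where
  asymm : ∀ u v, G.Adj u v → (A u v ↔ ¬ A v u)
  tie : ∀ u v w, G.Adj u v → G.Adj u w → v ≠ w → ¬ G.Adj v w → (A u v ↔ ¬ A u w)

theorem IsLocalOrientation.flip {A : V → V → Prop} (hA : IsLocalOrientation G A) :
    IsLocalOrientation G (fun u v => A v u) where
  asymm u v h := hA.asymm v u h.symm
  tie u v w huv huw hne hvw := by
    have h1 := hA.asymm u v huv
    have h2 := hA.asymm u w huw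
    have h3 := hA.tie u v w huv huw hne hvw
    grind only

theorem IsLocalOrientation.agree_symm {A B : V → V → Prop} (hA : IsLocalOrientation G A)
    (hB : IsLocalOrientation G B) {u v : V} (h : G.Adj u v) :
    (A u v ↔ B u v) ↔ (A v u ↔ B v u) := by
  have := hA.asymm u v h
  have := hB.asymm u v h
  grind only

theorem IsLocalOrientation.agree_tie {A B : V → V → Prop} (hA : IsLocalOrientation G A)
    (hB : IsLocalOrientation G B) {u v w : V} (huv : G.Adj u v) (huw : G.Adj u w) (hne : v ≠ w)
    (hvw : ¬ G.Adj v w) : (A u v ↔ B u v) ↔ (A u w ↔ B u w) := by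
  have := hA.tie u v w huv huw hne hvw
  have := hB.tie u v w huv huw hne hvw
  grind only

/-- No triangle has one edge on which `A` and `B` agree and two on which they differ. -/
def NoMixedTriangle (G : SimpleGraph V) (A B : V → V → Prop) : Prop :=
  ∀ b u a, G.Adj b u → G.Adj b a → G.Adj u a →
    (A u a ↔ B u a) → ¬ (A b u ↔ B b u) → ¬ (A b a ↔ B b a) → False

/-- Agreement spreads from an edge `u v` to an edge `u w`: if `v`, `w` are nonadjacent, by the tie;
otherwise by the triangle `u v w`, since one agreeing and one differing edge make a mixed triangle
for `B` or for its reversal, depending on the third edge. -/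
theorem agree_or_reversed (hG : G.Connected) {A B : V → V → Prop}
    (hA : IsLocalOrientation G A) (hB : IsLocalOrientation G B)
    (h1 : NoMixedTriangle G A B) (h2 : NoMixedTriangle G A (fun u v => B v u)) :
    (∀ u v, G.Adj u v → (A u v ↔ B u v)) ∨ (∀ u v, G.Adj u v → (A u v ↔ B v u)) := by
  have symm : ∀ u v, G.Adj u v → ((A u v ↔ B u v) ↔ (A v u ↔ B v u)) :=
    fun u v h => hA.agree_symm hB h
  have anti : ∀ u v, G.Adj u v → ((A u v ↔ B v u) ↔ ¬ (A u v ↔ B u v)) := by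
    intro u v h
    have := hB.asymm u v h
    grind only
  have key : ∀ u v w, G.Adj u v → G.Adj u w → (A u v ↔ B u v) → (A u w ↔ B u w) := by
    intro u v w huv huw hv
    by_contra hw
    by_cases hne : v = w
    · subst hne; exact hw hv
    by_cases hvw : G.Adj v w
    · by_cases hs : (A v w ↔ B v w)
      · refine h2 v u w huv.symm hvw huw ((anti _ _ huw).2 hw) ?_ ?_
        · rw [anti _ _ huv.symm, not_not]; exact (symm _ _ huv).1 hv
        · rw [anti _ _ hvw, not_not]; exact hs
      · exact h1 w u v huw.symm hvw.symm huv hv (fun h => hw ((symm _ _ huw).2 h))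
          (fun h => hs ((symm _ _ hvw).2 h))
    · exact hw ((hA.agree_tie hB huv huw hne hvw).1 hv)
  by_cases hex : ∃ u v, G.Adj u v ∧ (A u v ↔ B u v)
  · left
    obtain ⟨u, v, huv, hs⟩ := hex
    have hp : ∀ x, ∀ y, G.Adj x y → (A x y ↔ B x y) := by
      refine of_connected_of_adj hG ?_ (u := u) (fun y hy => key u v y huv hy hs)
      intro x y hxy hx z hyz
      exact key y x z hxy.symm hyz ((symm _ _ hxy).1 (hx y hxy))
    exact hp
  · right
    push Not at hex
    intro u v huv
    rw [anti _ _ huv]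
    have := hex u v huv
    grind only

/-- A distinguishing vertex of two adjacent vertices of a twin-free graph. -/
theorem TwinFree.exists_adj_not_adj (ht : TwinFree G) {u v : V} (h : G.Adj u v) :
    (∃ z, G.Adj u z ∧ z ≠ v ∧ ¬ G.Adj v z) ∨ (∃ z, G.Adj v z ∧ z ≠ u ∧ ¬ G.Adj u z) := by
  by_contra hcon
  push Not at hcon
  refine h.ne (ht u v ?_)
  ext z
  simp only [closedNbhd, Set.mem_insert_iff, SimpleGraph.mem_neighborSet]
  constructor
  · rintro (rfl | hz)
    · exact Or.inr h.symm
    · by_cases hzv : z = v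
      · exact Or.inl hzv
      · exact Or.inr (hcon.1 z hz hzv)
  · rintro (rfl | hz)
    · exact Or.inr h
    · by_cases hzu : z = u
      · exact Or.inl hzu
      · exact Or.inr (hcon.2 z hz hzu)

/-- The edges whose orientation is forced by that of `u a` in every local orientation. -/
inductive Tied (G : SimpleGraph V) (u a : V) : V → V → Prop
  | base : Tied G u a u a
  | symm {x y : V} : Tied G u a x y → Tied G u a y x
  | tie {x y z : V} : Tied G u a x y → G.Adj x z → y ≠ z → ¬ G.Adj y z → Tied G u a x z

/-- The vertices of the edges tied to `u a` form a module `S`. It contains a nonadjacent pair, and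
connectedness of `G` and of `Gᶜ` then yields a claw, which no local orientation admits: three
directions at its centre would be pairwise different. -/
theorem noMixedTriangle_of_compl_connected (ht : TwinFree G) (hG : G.Connected)
    (hGc : Gᶜ.Connected) {A B : V → V → Prop}
    (hA : IsLocalOrientation G A) (hB : IsLocalOrientation G B) : NoMixedTriangle G A B := by
  intro b u a hbu hba hua hs hbu' hba'
  -- The whole tie class inherits the position of `u a`: `b` is joined to both ends, `A` and `B`
  -- agree on the edge and differ on its edges to `b`.
  have apex : ∀ x y, Tied G u a x y → G.Adj x y ∧ (A x y ↔ B x y) ∧ G.Adj b x ∧ G.Adj b y ∧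
      ¬ (A b x ↔ B b x) ∧ ¬ (A b y ↔ B b y) := by
    intro x y h
    induction h with
    | base => exact ⟨hua, hs, hbu, hba, hbu', hba'⟩
    | @symm x y _ ih =>
      obtain ⟨h1, h2, h3, h4, h5, h6⟩ := ih
      exact ⟨h1.symm, (hA.agree_symm hB h1).1 h2, h4, h3, h6, h5⟩
    | @tie x y z _ hxz hyz hnyz ih =>
      obtain ⟨h1, h2, h3, h4, h5, h6⟩ := ih
      have h7 := (hA.agree_tie hB h1 hxz hyz hnyz).1 h2
      have hbz : b ≠ z := by
        rintro rfl
        exact hnyz h4.symm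
      have hadj : G.Adj b z := by
        by_contra hnot
        exact h5 ((hA.agree_symm hB h3).2 ((hA.agree_tie hB h3.symm hxz hbz hnot).2 h7))
      exact ⟨hxz, h7, h3, hadj, h5,
        fun h => h6 ((hA.agree_tie hB h4 hadj hyz hnyz).2 h)⟩
  let S : Set V := {x | ∃ y, Tied G u a x y}
  have hbS : ∀ x ∈ S, G.Adj b x := fun x ⟨y, hy⟩ => (apex x y hy).2.2.1
  -- A vertex adjacent to just one end of a tied edge would itself be drawn into `S` by a tie.
  have hmodule : ∀ c, c ∉ S → ∀ x y, Tied G u a x y → (G.Adj c u ↔ G.Adj c x) := by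
    intro c hc
    have hstep : ∀ x y, Tied G u a x y → G.Adj c x → G.Adj c y := by
      intro x y h hcx
      by_contra hcy
      have hne : y ≠ c := by
        rintro rfl
        exact hc ⟨x, h.symm⟩
      exact hc ⟨x, (h.tie hcx.symm hne (fun h => hcy h.symm)).symm⟩
    have hboth : ∀ x y, Tied G u a x y → (G.Adj c u ↔ G.Adj c x) ∧ (G.Adj c u ↔ G.Adj c y) := by
      intro x y h
      induction h with
      | base => exact ⟨Iff.rfl, hstep _ _ .base, hstep _ _ (.symm .base)⟩
      | symm _ ih => exact ih.symm
      | tie h h1 h2 h3 ih =>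
        exact ⟨ih.1, ih.1.trans ⟨hstep _ _ (h.tie h1 h2 h3), hstep _ _ (h.tie h1 h2 h3).symm⟩⟩
    exact fun x y h => (hboth x y h).1
  have huS : u ∈ S := ⟨a, .base⟩
  have hbnS : b ∉ S := fun h => (hbS b h).ne rfl
  -- A vertex distinguishing `u` from `a` is tied in, and is nonadjacent to one of them.
  obtain ⟨x, hx, z, hz, hxz, hnxz⟩ : ∃ x ∈ S, ∃ z ∈ S, x ≠ z ∧ ¬ G.Adj x z := by
    rcases ht.exists_adj_not_adj hua with ⟨z, h1, h2, h3⟩ | ⟨z, h1, h2, h3⟩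
    · exact ⟨a, ⟨u, .symm .base⟩, z, ⟨u, (Tied.base.tie h1 h2.symm h3).symm⟩, h2.symm, h3⟩
    · exact ⟨u, huS, z, ⟨a, ((Tied.symm .base).tie h1 h2.symm h3).symm⟩, h2.symm, h3⟩
  -- Otherwise everything outside `S` is joined to all of `S`, so `S` is closed under adjacency in
  -- `Gᶜ` and would contain `b`.
  obtain ⟨q₀, hq₀S, hq₀⟩ : ∃ q, q ∉ S ∧ ¬ G.Adj q u := by
    by_contra hcon
    push Not at hcon
    refine hbnS (of_connected_of_adj hGc (p := (· ∈ S)) ?_ huS b)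
    intro x y hxy hx
    by_contra hy
    obtain ⟨x', hx'⟩ := hx
    exact ((SimpleGraph.compl_adj _ _ _).1 hxy).2
      ((hmodule y hy x x' hx').1 (hcon y hy)).symm
  obtain ⟨p, q, hpS, hpu, hqS, hqu, hpq⟩ :
      ∃ p q, p ∉ S ∧ G.Adj p u ∧ q ∉ S ∧ ¬ G.Adj q u ∧ G.Adj p q := by
    by_contra hcon
    push Not at hcon
    refine (of_connected_of_adj hG (p := fun q => q ∉ S ∧ ¬ G.Adj q u) ?_ ⟨hq₀S, hq₀⟩ u).1 huS
    rintro q p hqp ⟨hq1, hq2⟩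
    have hpS : p ∉ S := by
      rintro ⟨y, hy⟩
      exact hq2 ((hmodule q hq1 p y hy).2 hqp)
    exact ⟨hpS, fun hpu => hcon p q hpS hpu hq1 hq2 hqp.symm⟩
  -- Now `p` is the centre of a claw with leaves `x`, `z`, `q`.
  obtain ⟨x', hx'⟩ := hx
  obtain ⟨z', hz'⟩ := hz
  have hpx := (hmodule p hpS x x' hx').1 hpu
  have hpz := (hmodule p hpS z z' hz').1 hpu
  have hqx := fun h => hqu ((hmodule q hqS x x' hx').2 h)
  have hqz := fun h => hqu ((hmodule q hqS z z' hz').2 h)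
  have hxq : q ≠ x := by rintro rfl; exact hqS ⟨x', hx'⟩
  have hzq : q ≠ z := by rintro rfl; exact hqS ⟨z', hz'⟩
  have e1 := hA.tie p x z hpx hpz hxz hnxz
  have e2 := hA.tie p q x hpq hpx hxq hqx
  have e3 := hA.tie p q z hpq hpz hzq hqz
  grind only

/-- A local orientation that is consistent on the paths of length two between two nonadjacent
vertices, as is the case for the left-to-right orientation of intervals. -/
def IsTwoPathConsistent (G : SimpleGraph V) (A : V → V → Prop) : Prop :=
  ∀ u z a b, u ≠ z → ¬ G.Adj u z → G.Adj u a → G.Adj a z → G.Adj u b → G.Adj b z →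
    (A u a ↔ A u b)

/-- Take `z` adjacent to `a` but not to `u`. A tie at `a` forces `b` to be adjacent to `z`, since
otherwise agreement would pass from `a u` through `a z` to `a b`. Then `u a z` and `u b z` are both
two-paths, and agreement passes from `u a` to `u b`. -/
theorem noMixedTriangle_of_isTwoPathConsistent (ht : TwinFree G) {A B : V → V → Prop}
    (hA : IsLocalOrientation G A) (hB : IsLocalOrientation G B)
    (hA' : IsTwoPathConsistent G A) (hB' : IsTwoPathConsistent G B) : NoMixedTriangle G A B := by
  have main : ∀ b u a z, G.Adj b u → G.Adj b a → G.Adj u a →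
      (A u a ↔ B u a) → ¬ (A b u ↔ B b u) → ¬ (A b a ↔ B b a) →
      G.Adj a z → z ≠ u → ¬ G.Adj u z → False := by
    intro b u a z hbu hba hua hs hbu' hba' haz hzu huz
    have a1 := hA.asymm u a hua
    have b1 := hB.asymm u a hua
    have a2 := hA.asymm b u hbu
    have b2 := hB.asymm b u hbu
    have a3 := hA.asymm b a hba
    have b3 := hB.asymm b a hba
    have a4 := hA.tie a u z hua.symm haz hzu.symm huz
    have b4 := hB.tie a u z hua.symm haz hzu.symm huz
    have hbz : G.Adj b z := by
      by_contra hbz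
      have hne : b ≠ z := by rintro rfl; exact huz hbu.symm
      have a5 := hA.tie a b z hba.symm haz hne hbz
      have b5 := hB.tie a b z hba.symm haz hne hbz
      grind only
    have a6 := hA' u z a b hzu.symm huz hua haz hbu.symm hbz
    have b6 := hB' u z a b hzu.symm huz hua haz hbu.symm hbz
    grind only
  intro b u a hbu hba hua hs hbu' hba'
  rcases ht.exists_adj_not_adj hua with ⟨z, h1, h2, h3⟩ | ⟨z, h1, h2, h3⟩
  · have := hA.asymm u a hua
    have := hB.asymm u a hua
    exact main b a u z hba hbu hua.symm (by grind only) hba' hbu' h1 h2 h3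
  · exact main b u a z hbu hba hua hs hbu' hba' h1 h2 h3

end Orientation

end PropRepr

namespace PropRepr

/-! ### Arithmetic of arcs on `Fin m`. -/

section Arcs

variable {m : ℕ}

theorem mem_arc_self_left (a b : Fin m) : a ∈ arc a b := by
  have : NeZero m := ⟨by have := a.isLt; omega⟩
  simp [arc]

theorem mem_arc_self_right (a b : Fin m) : b ∈ arc a b := le_refl (b - a)

theorem val_sub_eq_ite (a b : Fin m) :
    (b - a).val = if a.val ≤ b.val then b.val - a.val else m + b.val - a.val := by
  split_ifs with h
  · exact Fin.sub_val_of_le h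
  · exact Fin.coe_sub_iff_lt.2 (Fin.lt_def.2 (by omega))

theorem mem_arc_iff {a b x : Fin m} : x ∈ arc a b ↔
    (a.val ≤ b.val ∧ a.val ≤ x.val ∧ x.val ≤ b.val) ∨
      (b.val < a.val ∧ (a.val ≤ x.val ∨ x.val ≤ b.val)) := by
  have := a.isLt
  have := b.isLt
  have := x.isLt
  simp only [arc, Set.mem_ofPred_eq, Fin.le_def, val_sub_eq_ite]
  split_ifs <;> omega

theorem arc_eq_Icc {a b : Fin m} (h : a ≤ b) : arc a b = Set.Icc a b := by
  ext x
  simp only [mem_arc_iff, Set.mem_Icc, Fin.le_def] at *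
  omega

theorem arc_inter_nonempty_iff {a b c d : Fin m} :
    (arc a b ∩ arc c d).Nonempty ↔ c ∈ arc a b ∨ a ∈ arc c d := by
  constructor
  · rintro ⟨x, h1, h2⟩
    simp only [mem_arc_iff] at *
    omega
  · rintro (h | h)
    · exact ⟨c, h, mem_arc_self_left c d⟩
    · exact ⟨a, mem_arc_self_left a b, h⟩

theorem arc_subset_arc {a b c d : Fin m} (h1 : a ∈ arc c b) (h2 : b ∈ arc c d) :
    arc a b ⊆ arc c d := by
  intro x hx
  simp only [mem_arc_iff] at *
  omega

theorem card_arc (a b : Fin m) [Fintype (arc a b)] : Fintype.card (arc a b) = (b - a).val + 1 := by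
  have : NeZero m := ⟨by have := a.isLt; omega⟩
  rw [← Fin.card_Iic (b - a), ← Fintype.card_coe]
  refine Fintype.card_congr ((Equiv.subRight a).subtypeEquiv fun x => ?_)
  simp [arc]

theorem image_add_arc (a b s : Fin m) : (fun x => x + s) '' arc a b = arc (a + s) (b + s) := by
  have : NeZero m := ⟨by have := a.isLt; omega⟩
  ext x
  simp only [arc, Set.mem_image, Set.mem_ofPred_eq, add_sub_add_right_eq_sub]
  constructor
  · rintro ⟨y, hy, rfl⟩
    simpa using hy
  · intro h
    exact ⟨x - s, by rwa [sub_sub, add_comm s a], sub_add_cancel x s⟩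

theorem rev_mem_arc_rev {a b x : Fin m} : x.rev ∈ arc b.rev a.rev ↔ x ∈ arc a b := by
  have := a.isLt
  have := b.isLt
  have := x.isLt
  simp only [mem_arc_iff, Fin.val_rev]
  omega

theorem image_rev_arc (a b : Fin m) : Fin.rev '' arc a b = arc b.rev a.rev := by
  ext x
  rw [← Fin.rev_rev x, rev_mem_arc_rev, Fin.rev_injective.mem_set_image]

end Arcs

/-! ### Sharp models and what `Reaches` determines in them. -/

section Models

variable {V : Type*} {G : SimpleGraph V} {m : ℕ}

/-- A sharp proper arc representation of `G` with start points `l` and end points `r`. -/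
structure IsSharpModel (G : SimpleGraph V) (l r : V → Fin m) : Prop where
  bij : Function.Bijective (Sum.elim l r)
  adj : ∀ u v, u ≠ v → (G.Adj u v ↔ l v ∈ arc (l u) (r u) ∨ l u ∈ arc (l v) (r v))
  proper : ∀ u v, u ≠ v → l u ∈ arc (l v) (r u) → r u ∉ arc (l v) (r v)

/-- No two arcs of the system cover the circle by meeting at both ends. -/
def IsNormal (l r : V → Fin m) : Prop :=
  ∀ u v, u ≠ v → l v ∈ arc (l u) (r u) → l u ∉ arc (l v) (r v)

/-- The start point of the arc of `v` lies on the arc of `u`. -/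
def Reaches (l r : V → Fin m) (u v : V) : Prop := l v ∈ arc (l u) (r u)

/-- Of properness only one consequence is kept: the endpoints of two arcs never occur in the cyclic
order `l v`, `l u`, `r u`, `r v`, which would put one arc inside the other. -/
theorem IsProperArcRep.isSharpModel {α : V → Set (Fin m)} (h : IsProperArcRep G α)
    {l r : V → Fin m} (hα : ∀ v, α v = PropRepr.arc (l v) (r v)) (hb : Function.Bijective (Sum.elim l r)) :
    IsSharpModel G l r where
  bij := hb
  adj u v huv := by rw [h.rep u v huv, hα, hα, arc_inter_nonempty_iff]
  proper u v huv h1 h2 := h.proper u v huv (by rw [hα, hα]; exact arc_subset_arc h1 h2)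

namespace IsSharpModel

variable {l r : V → Fin m}

theorem l_ne (h : IsSharpModel G l r) {u v : V} (huv : u ≠ v) : (l u).val ≠ (l v).val := by
  intro e
  exact huv (Sum.inl.inj (h.bij.1 (a₁ := Sum.inl u) (a₂ := Sum.inl v) (Fin.ext e)))

theorem r_ne (h : IsSharpModel G l r) {u v : V} (huv : u ≠ v) : (r u).val ≠ (r v).val := by
  intro e
  exact huv (Sum.inr.inj (h.bij.1 (a₁ := Sum.inr u) (a₂ := Sum.inr v) (Fin.ext e)))

theorem l_ne_r (h : IsSharpModel G l r) (u v : V) : (l u).val ≠ (r v).val := by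
  intro e
  have := h.bij.1 (a₁ := Sum.inl u) (a₂ := Sum.inr v) (Fin.ext e)
  simp at this

/-- An arc that starts on the arc of `u` without lying inside it passes through `r u`, so two such
arcs meet there. -/
theorem adj_of_reaches (h : IsSharpModel G l r) {u v w : V} (hvw : v ≠ w) (huv : u ≠ v)
    (huw : u ≠ w) (h1 : Reaches l r u v) (h2 : Reaches l r u w) : G.Adj v w := by
  rw [h.adj v w hvw]
  have p1 := h.proper v u huv.symm
  have p2 := h.proper w u huw.symm
  simp only [Reaches, mem_arc_iff] at *
  omega

theorem adj_of_reached (h : IsSharpModel G l r) {u v w : V} (hvw : v ≠ w)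
    (h1 : Reaches l r v u) (h2 : Reaches l r w u) : G.Adj v w := by
  rw [h.adj v w hvw]
  simp only [Reaches, mem_arc_iff] at *
  omega

theorem isLocalOrientation (h : IsSharpModel G l r) (hn : IsNormal l r) :
    IsLocalOrientation G (Reaches l r) where
  asymm u v huv := by
    have h1 := (h.adj u v huv.ne).1 huv
    have h2 := hn u v huv.ne
    simp only [Reaches]
    tauto
  tie u v w huv huw hne hvw := by
    constructor
    · intro h1 h2
      exact hvw (h.adj_of_reaches hne huv.ne huw.ne h1 h2)
    · intro h2
      by_contra h1
      have h3 := (h.adj u v huv.ne).1 huv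
      have h4 := (h.adj u w huw.ne).1 huw
      exact hvw (h.adj_of_reached hne (h3.resolve_left h1) (h4.resolve_left h2))

/-- The end point of `w` lies on the arc of `u` if and only if the start point of `u` lies on the
arc of `w`. -/
theorem r_mem_arc_iff (h : IsSharpModel G l r) (u w : V) :
    r w ∈ arc (l u) (r u) ↔ Reaches l r w u := by
  rcases eq_or_ne w u with rfl | hne
  · exact ⟨fun _ => mem_arc_self_left _ _, fun _ => mem_arc_self_right _ _⟩
  have p1 := h.proper w u hne
  have p2 := h.proper u w hne.symm
  have := h.l_ne hne
  have := h.r_ne hne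
  simp only [Reaches, mem_arc_iff] at *
  omega

/-- This and `r_mem_arc_l_iff` express in terms of `Reaches` which endpoints lie between two start
points, so that they can be counted. -/
theorem l_mem_arc_l_iff (h : IsSharpModel G l r) (hn : IsNormal l r) {u v : V} (huv : u ≠ v)
    (hr : Reaches l r u v) (w : V) :
    l w ∈ arc (l u) (l v) ↔ Reaches l r u w ∧ Reaches l r w v := by
  rcases eq_or_ne w u with rfl | hwu
  · exact ⟨fun _ => ⟨mem_arc_self_left _ _, hr⟩, fun _ => mem_arc_self_left _ _⟩
  rcases eq_or_ne w v with rfl | hwv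
  · exact ⟨fun _ => ⟨hr, mem_arc_self_left _ _⟩, fun _ => mem_arc_self_right _ _⟩
  have p1 := h.proper w u hwu
  have n1 := hn u w hwu.symm
  have := h.l_ne hwu
  have := h.l_ne hwv
  simp only [Reaches, mem_arc_iff] at *
  omega

theorem r_mem_arc_l_iff (h : IsSharpModel G l r) (hn : IsNormal l r) {u v : V} (huv : u ≠ v)
    (hr : Reaches l r u v) (w : V) :
    r w ∈ arc (l u) (l v) ↔ Reaches l r w u ∧ ¬ Reaches l r w v := by
  have := h.l_ne_r v w
  rcases eq_or_ne w u with rfl | hwu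
  · have := h.l_ne huv
    simp only [Reaches, mem_arc_iff] at *
    omega
  have p1 := h.proper w u hwu
  have n1 := hn u w hwu.symm
  have := h.l_ne hwu
  simp only [Reaches, mem_arc_iff] at *
  omega

open Classical in
-- Sharpness enters here: the points of an arc correspond bijectively to the endpoints on it.
theorem card_arc_eq [Fintype V] (h : IsSharpModel G l r) (a b : Fin m) :
    (b - a).val + 1 = Fintype.card {w // l w ∈ arc a b} + Fintype.card {w // r w ∈ arc a b} := by
  rw [← card_arc, ← Fintype.card_sum]
  symm
  refine Fintype.card_congr (Equiv.trans ?_ ((Equiv.ofBijective _ h.bij).subtypeEquiv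
    (p := fun s => Sum.elim l r s ∈ arc a b) fun s => Iff.rfl))
  exact (Equiv.subtypeSum (p := fun s => Sum.elim l r s ∈ arc a b)).symm

open Classical in
theorem val_sub_eq_of_reaches_iff [Fintype V] {l' r' : V → Fin m} (h : IsSharpModel G l r)
    (hn : IsNormal l r) (h' : IsSharpModel G l' r') (hn' : IsNormal l' r')
    (hA : ∀ u v, Reaches l r u v ↔ Reaches l' r' u v) {u v : V} (hr : Reaches l r u v) :
    l v - l u = l' v - l' u := by
  rcases eq_or_ne u v with rfl | huv
  · have : NeZero m := ⟨by have := (l u).isLt; omega⟩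
    simp
  have e1 := h.card_arc_eq (l u) (l v)
  have e2 := h'.card_arc_eq (l' u) (l' v)
  simp only [h.l_mem_arc_l_iff hn huv hr, h.r_mem_arc_l_iff hn huv hr] at e1
  simp only [h'.l_mem_arc_l_iff hn' huv ((hA u v).1 hr),
    h'.r_mem_arc_l_iff hn' huv ((hA u v).1 hr), ← hA] at e2
  exact Fin.ext (by omega)

open Classical in
theorem length_eq_of_reaches_iff [Fintype V] {l' r' : V → Fin m} (h : IsSharpModel G l r)
    (h' : IsSharpModel G l' r') (hA : ∀ u v, Reaches l r u v ↔ Reaches l' r' u v) (u : V) :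
    r u - l u = r' u - l' u := by
  have e1 := h.card_arc_eq (l u) (r u)
  have e2 := h'.card_arc_eq (l' u) (r' u)
  simp only [h.r_mem_arc_iff] at e1
  simp only [h'.r_mem_arc_iff, ← hA] at e2
  have e3 : ∀ w, l w ∈ arc (l u) (r u) ↔ l' w ∈ arc (l' u) (r' u) := hA u
  simp only [e3] at e1
  exact Fin.ext (by omega)

/-- Reflection of a sharp model. -/
theorem rev (h : IsSharpModel G l r) :
    IsSharpModel G (fun v => (r v).rev) (fun v => (l v).rev) where
  bij := by
    have : Sum.elim (fun v => (r v).rev) (fun v => (l v).rev) =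
        Fin.rev ∘ Sum.elim l r ∘ Sum.swap := by
      ext s; cases s <;> rfl
    rw [this]
    exact Fin.rev_bijective.comp (h.bij.comp (Equiv.sumComm V V).bijective)
  adj u v huv := by
    simp only [rev_mem_arc_rev, h.r_mem_arc_iff]
    rw [h.adj u v huv, or_comm]
    rfl
  proper u v huv h1 h2 := by
    have p := h.proper u v huv
    have p' := h.proper v u huv.symm
    have := (l u).isLt
    have := (l v).isLt
    have := (r u).isLt
    have := (r v).isLt
    have := h.l_ne huv
    have := h.r_ne huv
    simp only [mem_arc_iff, Fin.val_rev] at *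
    omega

theorem reaches_rev (h : IsSharpModel G l r) (u v : V) :
    Reaches (fun v => (r v).rev) (fun v => (l v).rev) u v ↔ Reaches l r v u := by
  simp only [Reaches]
  rw [rev_mem_arc_rev, h.r_mem_arc_iff]
  rfl

theorem isNormal_rev (h : IsSharpModel G l r) (hn : IsNormal l r) :
    IsNormal (fun v => (r v).rev) (fun v => (l v).rev) := fun u v huv h1 h2 =>
  hn u v huv ((h.reaches_rev v u).1 h2) ((h.reaches_rev u v).1 h1)

end IsSharpModel

end Models
end PropRepr

namespace PropRepr

/-! ### Uniqueness of sharp representations, and the non-bipartite complement. -/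

section Uniqueness

variable {V : Type*} {G : SimpleGraph V} {m : ℕ} {l r l' r' : V → Fin m}

/-- If the arcs of `u` and `v` met at both ends, they would cover the circle, and the arc of a
vertex nonadjacent to `u` would lie inside that of `v`. -/
theorem IsSharpModel.isNormal_of_compl_connected (h : IsSharpModel G l r) (hGc : Gᶜ.Connected) :
    IsNormal l r := by
  intro u v huv h1 h2
  have hadj : G.Adj u v := (h.adj u v huv).2 (Or.inl h1)
  obtain ⟨w, hwu, hw⟩ : ∃ w, w ≠ u ∧ ¬ G.Adj u w := by
    by_contra hcon
    push Not at hcon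
    refine huv.symm (of_connected_of_adj hGc (p := (· = u)) ?_ rfl v)
    rintro x y hxy rfl
    by_contra hy
    exact ((SimpleGraph.compl_adj _ _ _).1 hxy).2 (hcon y hy)
  have hwv : w ≠ v := by rintro rfl; exact hw hadj
  have p := h.proper w v hwv
  have := h.l_ne huv
  rw [h.adj u w hwu.symm] at hw
  simp only [mem_arc_iff] at *
  omega

theorem IsSharpModel.reaches_iff_of_adj (h : IsSharpModel G l r) (h' : IsSharpModel G l' r')
    (hA : ∀ u v, G.Adj u v → (Reaches l r u v ↔ Reaches l' r' u v)) (u v : V) :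
    Reaches l r u v ↔ Reaches l' r' u v := by
  rcases eq_or_ne u v with rfl | huv
  · exact ⟨fun _ => mem_arc_self_left _ _, fun _ => mem_arc_self_left _ _⟩
  · by_cases hadj : G.Adj u v
    · exact hA u v hadj
    · have h1 := h.adj u v huv
      have h2 := h'.adj u v huv
      simp only [Reaches]
      tauto

/-- A sharp normal model is determined up to rotation by the orientation of the edges. -/
theorem IsSharpModel.exists_add_eq [Fintype V] (hG : G.Connected)
    (h : IsSharpModel G l r) (hn : IsNormal l r) (h' : IsSharpModel G l' r') (hn' : IsNormal l' r')
    (hA : ∀ u v, G.Adj u v → (Reaches l r u v ↔ Reaches l' r' u v)) :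
    ∃ s : Fin m, ∀ v, l' v = l v + s ∧ r' v = r v + s := by
  obtain ⟨v₀⟩ := hG.nonempty
  have : NeZero m := ⟨by have := (l v₀).isLt; omega⟩
  have hA := h.reaches_iff_of_adj h' hA
  have hstep : ∀ u v, Reaches l r u v → l' v - l v = l' u - l u := by
    intro u v huv
    have := h.val_sub_eq_of_reaches_iff hn h' hn' hA huv
    rw [sub_eq_sub_iff_add_eq_add] at this ⊢
    rw [add_comm (l' v), add_comm (l' u), this, add_comm]
  have hl : ∀ v, l' v - l v = l' v₀ - l v₀ := by
    refine of_connected_of_adj hG ?_ (u := v₀) rfl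
    intro u v huv hu
    rcases (h.adj u v huv.ne).1 huv with h1 | h1
    · rw [hstep u v h1, hu]
    · rw [← hstep v u h1, hu]
  have hl' : ∀ v, l' v = l v + (l' v₀ - l v₀) := fun v => by
    rw [← hl v]; abel
  refine ⟨_, fun v => ⟨hl' v, ?_⟩⟩
  have := h.length_eq_of_reaches_iff h' hA v
  rw [hl', sub_add_eq_sub_sub, sub_right_comm, sub_left_inj, eq_sub_iff_add_eq] at this
  exact this.symm

theorem eqUpToRotationReflection_of_sharp [Fintype V] (ht : TwinFree G) (hG : G.Connected)
    (hGc : Gᶜ.Connected) {α β : V → Set (Fin m)}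
    (hα : IsProperArcRep G α) (hα' : IsSharpArcs α) (hβ : IsProperArcRep G β)
    (hβ' : IsSharpArcs β) : EqUpToRotationReflection α β := by
  obtain ⟨l, r, hlr, hb⟩ := hα'
  obtain ⟨l', r', hlr', hb'⟩ := hβ'
  have h := hα.isSharpModel hlr hb
  have h' := hβ.isSharpModel hlr' hb'
  have hn := h.isNormal_of_compl_connected hGc
  have hn' := h'.isNormal_of_compl_connected hGc
  have hA := h.isLocalOrientation hn
  have hB := h'.isLocalOrientation hn'
  obtain ⟨v₀⟩ := hG.nonempty
  have : NeZero m := ⟨by have := (l v₀).isLt; omega⟩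
  rcases agree_or_reversed hG hA hB (noMixedTriangle_of_compl_connected ht hG hGc hA hB)
    (noMixedTriangle_of_compl_connected ht hG hGc hA hB.flip) with hag | hag
  · obtain ⟨s, hs⟩ := h.exists_add_eq hG hn h' hn' hag
    refine ⟨fun x => x + s, ⟨s, Or.inl fun _ => rfl⟩, fun v => ?_⟩
    rw [hlr, hlr', image_add_arc, (hs v).1, (hs v).2]
  · obtain ⟨s, hs⟩ := h.rev.exists_add_eq hG (h.isNormal_rev hn) h' hn'
      fun u v huv => (h.reaches_rev u v).trans
        ((hag v u huv.symm))
    -- `IsCircleSymmetry` rotates before reflecting, while `s` was found after reflecting;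
    -- exchanging the two changes the sign of the shift.
    refine ⟨fun x => Fin.rev (x + -s), ⟨-s, Or.inr fun _ => rfl⟩, fun v => ?_⟩
    have : (fun x : Fin m => Fin.rev (x + -s)) = (fun x => x + s) ∘ Fin.rev := by
      ext1 x
      simp only [Function.comp_apply, ← sub_eq_add_neg, Fin.rev_sub]
    rw [this, Set.image_comp, hlr, hlr', image_rev_arc, image_add_arc, (hs v).1, (hs v).2]

/-- If every arc of a sharp model is an interval, the model is normal. -/
theorem IsSharpModel.isNormal_of_le (h : IsSharpModel G l r) (hle : ∀ v, l v ≤ r v) :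
    IsNormal l r := by
  intro u v huv h1 h2
  have := hle u
  have := hle v
  have := h.l_ne huv
  simp only [mem_arc_iff, Fin.le_def] at *
  omega

/-- On a two-path `u a z` with `u`, `z` nonadjacent, the edge `u a` points to the right exactly when
`z` lies to the right of `u`; this does not involve `a`. -/
theorem IsSharpModel.isTwoPathConsistent_of_le (h : IsSharpModel G l r) (hle : ∀ v, l v ≤ r v) :
    IsTwoPathConsistent G (Reaches l r) := by
  have key : ∀ u z a, u ≠ z → ¬ G.Adj u z → G.Adj u a → G.Adj a z →
      (Reaches l r u a ↔ (l u).val < (l z).val) := by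
    intro u z a huz hnuz hua haz
    have h1 := h.adj u a hua.ne
    have h2 := h.adj a z haz.ne
    have h3 := h.adj u z huz
    have := hle u
    have := hle z
    have := hle a
    have := h.l_ne hua.ne
    have := h.l_ne haz.ne
    have := h.l_ne huz
    have p1 := h.proper u a hua.ne
    have p2 := h.proper z a haz.ne.symm
    simp only [hua, haz, hnuz, true_iff, false_iff] at h1 h2 h3
    simp only [Reaches, mem_arc_iff, Fin.le_def] at *
    omega
  intro u z a b huz hnuz hua haz hub hbz
  rw [key u z a huz hnuz hua haz, key u z b huz hnuz hub hbz]

/-- On a segment the shift between the models is a constant integer. It is nonnegative because some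
start point of the first model is the first point of the segment; exchanging the models then shows
that it is zero. -/
theorem IsSharpModel.l_le_of_le [Fintype V] (hG : G.Connected)
    (h : IsSharpModel G l r) (hle : ∀ v, l v ≤ r v) (h' : IsSharpModel G l' r')
    (hle' : ∀ v, l' v ≤ r' v)
    (hA : ∀ u v, G.Adj u v → (Reaches l r u v ↔ Reaches l' r' u v)) (v : V) : l v ≤ l' v := by
  have hn := h.isNormal_of_le hle
  have hn' := h'.isNormal_of_le hle'
  have hA := h.reaches_iff_of_adj h' hA
  -- For intervals `Reaches` gives `l u ≤ l v` in both models, so the differences modulo `m` are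
  -- true differences.
  have hstep : ∀ u v, Reaches l r u v →
      ((l' v).val : ℤ) - (l v).val = (l' u).val - (l u).val := by
    intro u v huv
    have e := congrArg Fin.val (h.val_sub_eq_of_reaches_iff hn h' hn' hA huv)
    have e' := (hA u v).1 huv
    have := hle u
    have := hle' u
    rw [val_sub_eq_ite, val_sub_eq_ite] at e
    simp only [Reaches, mem_arc_iff, Fin.le_def] at *
    split_ifs at e <;> omega
  have : NeZero m := ⟨by have := (l v).isLt; omega⟩
  obtain ⟨v₀, hv₀⟩ : ∃ v₀, l v₀ = 0 := by
    obtain ⟨w | w, hw⟩ := h.bij.2 0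
    · exact ⟨w, hw⟩
    · exact ⟨w, le_antisymm ((hle w).trans hw.le) (Fin.zero_le _)⟩
  have hl : ((l' v).val : ℤ) - (l v).val = (l' v₀).val - (l v₀).val := by
    refine of_connected_of_adj hG
      (p := fun v => ((l' v).val : ℤ) - (l v).val = (l' v₀).val - (l v₀).val) ?_ (u := v₀) rfl v
    intro u v huv hu
    rcases (h.adj u v huv.ne).1 huv with h1 | h1
    · rw [hstep u v h1, hu]
    · rw [← hstep v u h1, hu]
  rw [Fin.le_def]
  have : (l v₀).val = 0 := by simp [hv₀]
  omega

theorem IsSharpModel.eq_of_le [Fintype V] (hG : G.Connected)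
    (h : IsSharpModel G l r) (hle : ∀ v, l v ≤ r v) (h' : IsSharpModel G l' r')
    (hle' : ∀ v, l' v ≤ r' v)
    (hA : ∀ u v, G.Adj u v → (Reaches l r u v ↔ Reaches l' r' u v)) (v : V) :
    l' v = l v ∧ r' v = r v := by
  have : NeZero m := ⟨by have := (l v).isLt; omega⟩
  have e : l' v = l v := le_antisymm
    (h'.l_le_of_le hG hle' h hle (fun u v huv => (hA u v huv).symm) v)
    (h.l_le_of_le hG hle h' hle' hA v)
  refine ⟨e, ?_⟩
  have := h.length_eq_of_reaches_iff h' (h.reaches_iff_of_adj h' hA) v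
  rw [e, sub_left_inj] at this
  exact this.symm

theorem IsProperIntervalRep.isProperArcRep {α : V → Set (Fin m)} (h : IsProperIntervalRep G α) :
    IsProperArcRep G α where
  arc v := by
    rcases h.interval v with h1 | ⟨a, b, hab, h1⟩
    · exact Or.inl h1
    · exact Or.inr (Or.inr ⟨a, b, by rw [h1, arc_eq_Icc hab]⟩)
  rep := h.rep
  proper := h.proper

theorem eqUpToReflection_of_sharp [Fintype V] (ht : TwinFree G) (hG : G.Connected)
    {α β : V → Set (Fin m)}
    (hα : IsProperIntervalRep G α) (hα' : IsSharpIntervals α) (hβ : IsProperIntervalRep G β)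
    (hβ' : IsSharpIntervals β) : EqUpToReflection α β := by
  obtain ⟨l, r, hlr, hb⟩ := hα'
  obtain ⟨l', r', hlr', hb'⟩ := hβ'
  have hle := fun v => (hlr v).1
  have hle' := fun v => (hlr' v).1
  have hlr : ∀ v, α v = arc (l v) (r v) := fun v => by rw [arc_eq_Icc (hle v), (hlr v).2]
  have hlr' : ∀ v, β v = arc (l' v) (r' v) := fun v => by rw [arc_eq_Icc (hle' v), (hlr' v).2]
  have h := hα.isProperArcRep.isSharpModel hlr hb
  have h' := hβ.isProperArcRep.isSharpModel hlr' hb'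
  have hn := h.isNormal_of_le hle
  have hn' := h'.isNormal_of_le hle'
  have hA := h.isLocalOrientation hn
  have hB := h'.isLocalOrientation hn'
  have hle'' : ∀ v, (r' v).rev ≤ (l' v).rev := fun v => Fin.rev_le_rev.2 (hle' v)
  -- The reversed orientation is that of the reflected model, which again consists of intervals.
  have hB' : IsTwoPathConsistent G (fun u v => Reaches l' r' v u) := by
    have := h'.rev.isTwoPathConsistent_of_le hle''
    intro u z a b h1 h2 h3 h4 h5 h6
    have := this u z a b h1 h2 h3 h4 h5 h6
    rwa [h'.reaches_rev, h'.reaches_rev] at this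
  rcases agree_or_reversed hG hA hB
    (noMixedTriangle_of_isTwoPathConsistent ht hA hB (h.isTwoPathConsistent_of_le hle)
      (h'.isTwoPathConsistent_of_le hle'))
    (noMixedTriangle_of_isTwoPathConsistent ht hA hB.flip (h.isTwoPathConsistent_of_le hle) hB')
    with hag | hag
  · left
    funext v
    obtain ⟨h1, h2⟩ := h.eq_of_le hG hle h' hle' hag v
    rw [hlr, hlr', h1, h2]
  · right
    intro v
    obtain ⟨h1, h2⟩ := h.rev.eq_of_le hG (fun v => Fin.rev_le_rev.2 (hle v)) h' hle'
      (fun u v huv => (h.reaches_rev u v).trans (hag v u huv.symm)) v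
    rw [hlr, hlr', h1, h2, image_rev_arc]

/-- If a graph with a sharp proper arc representation has a non-bipartite complement, then the
complement is connected. -/
theorem IsSharpModel.compl_connected_of_not_isBipartite [Nonempty V] (h : IsSharpModel G l r)
    (hb : ¬ Gᶜ.IsBipartite) : Gᶜ.Connected := by
  classical
  refine ⟨fun u v => ?_⟩
  by_contra hnot
  -- A vertex in another component of `Gᶜ` than `x`, hence adjacent to `x` in `G`, chosen to depend
  -- only on the component of `x`.
  let c : V → V := fun x => if Gᶜ.Reachable u x then v else u
  have hc : ∀ x y, Gᶜ.Adj x y → c x = c y := by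
    intro x y hxy
    have : Gᶜ.Reachable u x ↔ Gᶜ.Reachable u y :=
      ⟨fun h => h.trans hxy.reachable, fun h => h.trans hxy.symm.reachable⟩
    simp only [c, this]
  have hne : ∀ x, x ≠ c x ∧ G.Adj x (c x) := by
    intro x
    have h1 : ¬ Gᶜ.Reachable x (c x) := by
      simp only [c]
      split_ifs with hx
      · exact fun h => hnot (hx.trans h)
      · exact fun h => hx h.symm
    have h2 : x ≠ c x := fun h => h1 (h ▸ SimpleGraph.Reachable.refl _)
    refine ⟨h2, ?_⟩
    by_contra h3
    exact h1 (SimpleGraph.Adj.reachable ((SimpleGraph.compl_adj _ _ _).2 ⟨h2, h3⟩))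
  -- Colour `x` by the direction of its edge to `c x`. Vertices adjacent in `Gᶜ` share `c x`, and
  -- two on the same side of it would be adjacent in `G`.
  refine hb ((SimpleGraph.Coloring.mk (fun x => decide (Reaches l r x (c x))) ?_ :
    Gᶜ.Coloring Bool).colorable)
  intro x y hxy he
  have hcx := hne x
  have hcy := hne y
  rw [← hc x y hxy] at he hcy
  rw [SimpleGraph.compl_adj] at hxy
  by_cases hx : Reaches l r x (c x)
  · have hy : Reaches l r y (c x) := by simpa [hx] using he
    exact hxy.2 (h.adj_of_reached hxy.1 hx hy)
  · have hy : ¬ Reaches l r y (c x) := by simpa [hx] using he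
    exact hxy.2 (h.adj_of_reaches hxy.1 hcx.1.symm hcy.1.symm
      (((h.adj _ _ hcx.1).1 hcx.2).resolve_left hx) (((h.adj _ _ hcy.1).1 hcy.2).resolve_left hy))

end Uniqueness
end PropRepr

namespace PropRepr

/-! ### Existence of sharp representations. -/

section Existence

variable {V : Type*} {G : SimpleGraph V} {m : ℕ}

theorem exists_bijective_le_iff [Fintype V] (key : V ⊕ V → ℕ) (hkey : Function.Injective key) :
    ∃ e : V ⊕ V → Fin (2 * Fintype.card V), Function.Bijective e ∧
      ∀ s t, (e s).val ≤ (e t).val ↔ key s ≤ key t := by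
  classical
  have hcard : (Finset.univ.image key).card = 2 * Fintype.card V := by
    rw [Finset.card_image_of_injective _ hkey, Finset.card_univ, Fintype.card_sum, two_mul]
  let o := Finset.orderIsoOfFin (Finset.univ.image key) hcard
  let e : V ⊕ V → Fin (2 * Fintype.card V) :=
    fun s => o.symm ⟨key s, Finset.mem_image_of_mem _ (Finset.mem_univ s)⟩
  have he : ∀ s t, e s ≤ e t ↔ key s ≤ key t := fun s t => by
    simp only [e, OrderIso.le_iff_le, Subtype.mk_le_mk]
  refine ⟨e, ?_, he⟩
  rw [Fintype.bijective_iff_injective_and_card]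
  refine ⟨fun s t hst => hkey (le_antisymm ((he s t).1 hst.le) ((he t s).1 hst.ge)), ?_⟩
  simp [two_mul]

/-- The order of endpoints in which start points precede the end points at the same position. -/
def endpointKey (a b : V → ℕ) : V ⊕ V → ℕ := Sum.elim (fun v => 2 * a v) (fun v => 2 * b v + 1)

theorem exists_endpoints [Fintype V] {a b : V → ℕ} (ha : Function.Injective a)
    (hb : Function.Injective b) : ∃ l r : V → Fin (2 * Fintype.card V),
      Function.Bijective (Sum.elim l r) ∧
      (∀ u v, (l u).val ≤ (l v).val ↔ a u ≤ a v) ∧ (∀ u v, (l u).val ≤ (r v).val ↔ a u ≤ b v) ∧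
      (∀ u v, (r u).val ≤ (l v).val ↔ b u < a v) ∧ (∀ u v, (r u).val ≤ (r v).val ↔ b u ≤ b v) := by
  have hkey : Function.Injective (endpointKey a b) := by
    rintro (u | u) (v | v) h <;> simp only [endpointKey, Sum.elim_inl, Sum.elim_inr] at h
    · exact congrArg _ (ha (by omega))
    · omega
    · omega
    · exact congrArg _ (hb (by omega))
  obtain ⟨e, he, hle⟩ := exists_bijective_le_iff _ hkey
  refine ⟨e ∘ Sum.inl, e ∘ Sum.inr, by rwa [Sum.elim_comp_inl_inr], ?_, ?_, ?_, ?_⟩ <;>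
    intro u v <;> rw [Function.comp_apply, Function.comp_apply, hle] <;>
    simp only [endpointKey, Sum.elim_inl, Sum.elim_inr] <;> omega

theorem exists_sharp_intervals_of_endpoints [Fintype V] {a b : V → ℕ} (hab : ∀ v, a v ≤ b v)
    (hadj : ∀ u v, u ≠ v → (G.Adj u v ↔ a u ≤ b v ∧ a v ≤ b u))
    (hp : ∀ u v, u ≠ v → a v ≤ a u → b v < b u) :
    ∃ α : V → Set (Fin (2 * Fintype.card V)), IsProperIntervalRep G α ∧ IsSharpIntervals α := by
  have ha : Function.Injective a := by
    intro u v h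
    by_contra hne
    have := hp u v hne h.ge
    have := hp v u (Ne.symm hne) h.le
    omega
  have hb : Function.Injective b := by
    intro u v h
    by_contra hne
    have := hp u v hne
    have := hp v u (Ne.symm hne)
    omega
  obtain ⟨l, r, hbij, h1, h2, h3, h4⟩ := exists_endpoints ha hb
  have hle : ∀ v, l v ≤ r v := fun v => Fin.le_def.2 ((h2 v v).2 (hab v))
  refine ⟨fun v => Set.Icc (l v) (r v), ⟨fun v => Or.inr ⟨_, _, hle v, rfl⟩, ?_, ?_⟩,
    l, r, fun v => ⟨hle v, rfl⟩, hbij⟩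
  · intro u v huv
    rw [hadj u v huv, Set.Icc_inter_Icc, Set.nonempty_Icc, sup_le_iff, le_inf_iff, le_inf_iff]
    have := hle u
    have := hle v
    simp only [Fin.le_def, h2] at *
    tauto
  · intro u v huv hsub
    rw [Set.Icc_subset_Icc_iff (hle u), Fin.le_def, Fin.le_def, h1, h4] at hsub
    have := hp u v huv hsub.1
    omega

theorem IsProper.nonempty [Nontrivial V] {α : V → Set (Fin m)} (h : IsProper α) (v : V) :
    (α v).Nonempty := by
  obtain ⟨u, hu⟩ := exists_ne v
  rw [Set.nonempty_iff_ne_empty]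
  intro he
  exact h v u hu.symm (he ▸ Set.empty_subset _)

theorem IsProper.ne_univ [Nontrivial V] {α : V → Set (Fin m)} (h : IsProper α) (v : V) :
    α v ≠ Set.univ := by
  obtain ⟨u, hu⟩ := exists_ne v
  intro he
  exact h u v hu (he ▸ Set.subset_univ _)

/-- With at most one vertex properness is vacuous: a given set may be empty or the whole circle and
need not supply endpoints, so this case is built directly. -/
theorem exists_sharp_intervals_of_subsingleton [Fintype V] [Subsingleton V] :
    ∃ α : V → Set (Fin (2 * Fintype.card V)), IsProperIntervalRep G α ∧ IsSharpIntervals α :=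
  exists_sharp_intervals_of_endpoints (a := fun _ => 0) (b := fun _ => 0) (fun _ => le_rfl)
    (fun u v huv => absurd (Subsingleton.elim u v) huv)
    (fun u v huv => absurd (Subsingleton.elim u v) huv)

theorem IsProperIntervalGraph.exists_sharp [Fintype V] (h : IsProperIntervalGraph G) :
    ∃ α : V → Set (Fin (2 * Fintype.card V)), IsProperIntervalRep G α ∧ IsSharpIntervals α := by
  rcases subsingleton_or_nontrivial V with hV | hV
  · exact exists_sharp_intervals_of_subsingleton
  obtain ⟨m, α, hα⟩ := h
  have : ∀ v, ∃ a b : Fin m, a ≤ b ∧ α v = Set.Icc a b := fun v =>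
    (hα.interval v).resolve_left (hα.proper.nonempty v).ne_empty
  choose a b hab hαab using this
  refine exists_sharp_intervals_of_endpoints (a := fun v => (a v).val) (b := fun v => (b v).val)
    hab (fun u v huv => ?_) (fun u v huv h => ?_)
  · have := hab u
    have := hab v
    rw [hα.rep u v huv, hαab, hαab, Set.Icc_inter_Icc, Set.nonempty_Icc, sup_le_iff, le_inf_iff,
      le_inf_iff]
    simp only [Fin.le_def] at *
    tauto
  · by_contra hcon
    refine hα.proper u v huv ?_
    rw [hαab, hαab]
    exact Set.Icc_subset_Icc h (Fin.le_def.2 (not_lt.1 hcon))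

/-- Discarding the points that are not endpoints may close the gap between `b v` and `a v`, making
the new arc of `v` the whole circle. This is the only way a containment can arise, and twin-freeness
excludes it. -/
theorem IsPCAGraph.exists_sharp [Fintype V] (ht : TwinFree G) (h : IsPCAGraph G) :
    ∃ α : V → Set (Fin (2 * Fintype.card V)), IsProperArcRep G α ∧ IsSharpArcs α := by
  rcases subsingleton_or_nontrivial V with hV | hV
  · obtain ⟨α, h1, l, r, h2, h3⟩ := exists_sharp_intervals_of_subsingleton (G := G)
    exact ⟨α, h1.isProperArcRep, l, r, fun v => by rw [arc_eq_Icc (h2 v).1, (h2 v).2], h3⟩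
  obtain ⟨m, α, hα⟩ := h
  have : ∀ v, ∃ a b : Fin m, α v = arc a b := fun v =>
    ((hα.arc v).resolve_left (hα.proper.nonempty v).ne_empty).resolve_left (hα.proper.ne_univ v)
  choose a b hαab using this
  have hp : ∀ u v, u ≠ v → a u ∈ arc (a v) (b u) → b u ∉ arc (a v) (b v) := fun u v huv h1 h2 =>
    hα.proper u v huv (by rw [hαab, hαab]; exact arc_subset_arc h1 h2)
  have hadj : ∀ u v, u ≠ v → (G.Adj u v ↔ a v ∈ arc (a u) (b u) ∨ a u ∈ arc (a v) (b v)) :=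
    fun u v huv => by rw [hα.rep u v huv, hαab, hαab, arc_inter_nonempty_iff]
  have ha : Function.Injective fun v => (a v).val := by
    intro u v h
    by_contra hne
    have p1 := hp u v hne
    have p2 := hp v u (Ne.symm hne)
    simp only [mem_arc_iff] at *
    omega
  have hb : Function.Injective fun v => (b v).val := by
    intro u v h
    by_contra hne
    have p1 := hp u v hne
    have p2 := hp v u (Ne.symm hne)
    simp only [mem_arc_iff] at *
    omega
  obtain ⟨l, r, hbij, h1, h2, h3, h4⟩ := exists_endpoints ha hb
  have hl : ∀ u v, l v ∈ arc (l u) (r u) ↔ a v ∈ arc (a u) (b u) := by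
    intro u v
    have e1 := h2 u u
    have e2 := h3 u u
    have e3 := h1 u v
    have e4 := h2 v u
    simp only [mem_arc_iff]
    omega
  have hr : ∀ u v, r v ∈ arc (l u) (r u) ↔ b v ∈ arc (a u) (b u) := by
    intro u v
    have e1 := h2 u u
    have e2 := h3 u u
    have e3 := h2 u v
    have e4 := h4 v u
    simp only [mem_arc_iff]
    omega
  refine ⟨fun v => arc (l v) (r v), ⟨fun v => Or.inr (Or.inr ⟨_, _, rfl⟩), ?_, ?_⟩,
    l, r, fun v => rfl, hbij⟩
  · intro u v huv
    rw [arc_inter_nonempty_iff, hl, hl, hadj u v huv]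
  · intro u v huv hsub
    have hau := (hl v u).1 (hsub (mem_arc_self_left (l u) (r u)))
    have hbu := (hr v u).1 (hsub (mem_arc_self_right (l u) (r u)))
    -- Both ends of `u` lie on the old arc of `v`, but `u` is not inside it, so `u` leaves `v` at
    -- one end and returns at the other: together they cover the circle.
    have puv : a u ∉ arc (a v) (b u) := fun h => hp u v huv h hbu
    have hcover : ∀ x, x ∈ arc (a u) (b u) ∨ x ∈ arc (a v) (b v) := by
      intro x
      simp only [mem_arc_iff] at *
      omega
    -- By the covering and the new containment, every old arc has both ends on that of `v`. Not
    -- being inside it, it must cross the gap and so contain `a v`; all arcs then share this point.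
    have huniv : ∀ w, w ≠ v → a v ∈ arc (a w) (b w) := by
      intro w hwv
      have haw : a w ∈ arc (a v) (b v) :=
        (hcover (a w)).elim (fun h => (hl v w).1 (hsub ((hl u w).2 h))) id
      have hbw : b w ∈ arc (a v) (b v) :=
        (hcover (b w)).elim (fun h => (hr v w).1 (hsub ((hr u w).2 h))) id
      have pwv : a w ∉ arc (a v) (b w) := fun h => hp w v hwv h hbw
      clear hl hr hsub hcover hp
      simp only [mem_arc_iff] at haw hbw pwv ⊢
      omega
    have hcomplete : ∀ w x, w ≠ x → G.Adj w x := by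
      intro w x hwx
      rw [hadj w x hwx]
      have hw : a v ∈ arc (a w) (b w) := by
        rcases eq_or_ne w v with rfl | h
        · exact mem_arc_self_left _ _
        · exact huniv w h
      have hx : a v ∈ arc (a x) (b x) := by
        rcases eq_or_ne x v with rfl | h
        · exact mem_arc_self_left _ _
        · exact huniv x h
      exact arc_inter_nonempty_iff.1 ⟨a v, hw, hx⟩
    refine huv (ht u v ?_)
    ext z
    simp only [closedNbhd, Set.mem_insert_iff, SimpleGraph.mem_neighborSet]
    have := hcomplete u z
    have := hcomplete v z
    grind

end Existence
end PropRepr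

theorem mainTheorem9 {V : Type*} [Fintype V] (G : SimpleGraph V)
    (htwin : PropRepr.TwinFree G) (hconn : G.Connected) :
    (PropRepr.IsProperIntervalGraph G →
      (∃ α : V → Set (Fin (2 * Fintype.card V)),
        PropRepr.IsProperIntervalRep G α ∧ PropRepr.IsSharpIntervals α) ∧
      ∀ α β : V → Set (Fin (2 * Fintype.card V)),
        PropRepr.IsProperIntervalRep G α → PropRepr.IsSharpIntervals α →
        PropRepr.IsProperIntervalRep G β → PropRepr.IsSharpIntervals β →
        PropRepr.EqUpToReflection α β) ∧
    (PropRepr.IsPCAGraph G → (¬ Gᶜ.IsBipartite ∨ Gᶜ.Connected) →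
      (∃ α : V → Set (Fin (2 * Fintype.card V)),
        PropRepr.IsProperArcRep G α ∧ PropRepr.IsSharpArcs α) ∧
      ∀ α β : V → Set (Fin (2 * Fintype.card V)),
        PropRepr.IsProperArcRep G α → PropRepr.IsSharpArcs α →
        PropRepr.IsProperArcRep G β → PropRepr.IsSharpArcs β →
        PropRepr.EqUpToRotationReflection α β) := by
  refine ⟨fun h => ⟨h.exists_sharp, fun α β hα hα' hβ hβ' =>
    PropRepr.eqUpToReflection_of_sharp htwin hconn hα hα' hβ hβ'⟩,
    fun h hc => ⟨h.exists_sharp htwin, fun α β hα hα' hβ hβ' => ?_⟩⟩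
  have := hconn.nonempty
  have hGc : Gᶜ.Connected := by
    refine hc.elim (fun hb => ?_) id
    obtain ⟨l, r, hlr, hbij⟩ := hα'
    exact (hα.isSharpModel hlr hbij).compl_connected_of_not_isBipartite hb
  exact PropRepr.eqUpToRotationReflection_of_sharp htwin hconn hGc hα hα' hβ hβ'
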